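/- Let $r\ge 1$ be an integer. For a subset $\mathcal X\subset\mathbb R^n$ for which there is a polynomial $E(\mathcal X,t)\in\mathbb Q[t]$ with $E(\mathcal X,t)=\#(t\mathcal X\cap\mathbb Z^n)$ for all integers $t>0$, let $$E^*(\mathcal X,z)=(1-z)^{n+1}\sum_{t\ge 0}E(\mathcal X,t)\,z^t$$ be its Ehrhart series. For $n\ge 1$ and $1\le k\le rn$ let $$\mathcal A^{(r)}_{n,k}=\Big\{v\in[0,r)^n : k-1\le \sum_i v_i<k\Big\},\qquad A^{(r)}_{n,k}(z)=E^*(\mathcal A^{(r)}_{n,k},z),$$ with the conventions $A^{(r)}_{n,0}(z)=\delta_{n,0}$ and $A^{(r)}_{n,k}(z)=0$ for $k>rn$, and put $$A^{(r)}_n(y,z)=\sum_{k=0}^{rn}y^kA^{(r)}_{n,k}(z).$$ An $r$-colored permutation of size $n$ is a pair $(\sigma,c)$ with $\sigma\in\mathfrak S_n$ and $c\in\{0,\dots,r-1\}^n$; the set of these is $\mathfrak S_n^{(r)}$. Write $\mathrm{des}(\sigma)=\#\{i<n:\sigma_i>\sigma_{i+1}\}$, and for $n\ge1$ $$\mathrm{fdes}(\sigma,c)=r\cdot\#\{i<n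 : c_i>c_{i+1},\text{ or } c_i=c_{i+1}\text{ and }\sigma_i>\sigma_{i+1}\}+c_n .$$ Theorem. $A^{(r)}_0(y,z)=1$, and for every $n\ge 1$ $$A^{(r)}_n(y,z)=\sum_{(\sigma,c)\in\mathfrak S_n^{(r)}}y^{\mathrm{fdes}(\sigma,c)+1}z^{\mathrm{des}(\sigma^{-1})+1}.$$ Moreover, as formal power series in $x,y,z$ over $\mathbb Q$ (the sum over $m$ on the right being coefficientwise convergent), $$\sum_{n\ge0}A^{(r)}_n(y,z)\,x^n=(1-y)(1-z)\sum_{m\ge0}z^m\left(1-y\Big(\frac1{1-x(1-y^r)(1-z)}\Big)^m\right)^{-1}.$$ -/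

import Mathlib

open scoped Pointwise
open scoped PowerSeries.WithPiTopology

noncomputable section

/-! ### Ehrhart polynomials and Ehrhart series -/

/-- The number of points of the integer lattice `ℤⁿ` lying in the dilate `t 𝒳 = {t x : x ∈ 𝒳}`. -/
def latticeCount {n : ℕ} (P : Set (Fin n → ℝ)) (t : ℕ) : ℕ :=
  Set.ncard {p : Fin n → ℤ | (fun i => (p i : ℝ)) ∈ (t : ℝ) • P}

/-- `E` is an Ehrhart polynomial of `P`: it counts the lattice points of `t P` for all integers
`t > 0` (nothing is required at `t = 0`). -/
def IsEhrhartPolynomial {n : ℕ} (P : Set (Fin n → ℝ)) (E : Polynomial ℚ) : Prop :=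
  ∀ t : ℕ, 0 < t → E.eval (t : ℚ) = (latticeCount P t : ℚ)

/-- There is at most one Ehrhart polynomial. -/
theorem IsEhrhartPolynomial.unique {n : ℕ} {P : Set (Fin n → ℝ)} {E F : Polynomial ℚ}
    (hE : IsEhrhartPolynomial P E) (hF : IsEhrhartPolynomial P F) : E = F := by
  refine Polynomial.eq_of_infinite_eval_eq E F ?_
  refine Set.Infinite.mono ?_ (Set.infinite_range_of_injective
    (f := fun t : ℕ => ((t + 1 : ℕ) : ℚ)) ?_)
  · rintro _ ⟨t, rfl⟩
    exact (hE (t + 1) t.succ_pos).trans (hF (t + 1) t.succ_pos).symm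
  · intro a b h
    simpa using h

open Classical in
/-- The Ehrhart polynomial of `P`, i.e. the unique polynomial `E` such that
`E(t) = #(t P ∩ ℤⁿ)` for all integers `t > 0` (and `0` if there is no such polynomial). -/
def ehrhartPolynomial {n : ℕ} (P : Set (Fin n → ℝ)) : Polynomial ℚ :=
  if h : ∃ E : Polynomial ℚ, IsEhrhartPolynomial P E then h.choose else 0

/-- The Ehrhart series `E*(P, z) = (1 - z)^(n+1) ∑_{t ≥ 0} E(P, t) z^t`, a formal power series in
`z`.  Its `t = 0` term uses the value at `0` of the Ehrhart polynomial. -/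
def ehrhartSeries {n : ℕ} (P : Set (Fin n → ℝ)) : PowerSeries ℚ :=
  (1 - PowerSeries.X) ^ (n + 1) *
    PowerSeries.mk fun t : ℕ => (ehrhartPolynomial P).eval (t : ℚ)

/-! ### The slices of the half-open cube and the polynomials `A_n^{(r)}(y, z)` -/

/-- The slice `{v ∈ [0, r)ⁿ : k - 1 ≤ ∑ vᵢ < k}` of the half-open cube. -/
def halfOpenSlice (r n k : ℕ) : Set (Fin n → ℝ) :=
  {v | (∀ i, 0 ≤ v i ∧ v i < (r : ℝ)) ∧ (k : ℝ) - 1 ≤ ∑ i, v i ∧ ∑ i, v i < (k : ℝ)}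

/-- `A_{n,k}^{(r)}(z)`: the Ehrhart series of the slice if `n ≥ 1` and `1 ≤ k ≤ r n`, with the
conventions `A_{n,0}^{(r)}(z) = δ_{n,0}` and `A_{n,k}^{(r)}(z) = 0` for `k > r n`. -/
def biEulerianCoeff (r n k : ℕ) : PowerSeries ℚ :=
  if k = 0 then (if n = 0 then 1 else 0)
  else if k ≤ r * n then ehrhartSeries (halfOpenSlice r n k)
  else 0

/-- `A_n^{(r)}(y, z) = ∑_{k=0}^{r n} y^k A_{n,k}^{(r)}(z)`, as a polynomial in `y` whose
coefficients are formal power series in `z`. -/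
def biEulerian (r n : ℕ) : Polynomial (PowerSeries ℚ) :=
  ∑ k ∈ Finset.range (r * n + 1), Polynomial.X ^ k * Polynomial.C (biEulerianCoeff r n k)

/-! ### Colored permutations -/

/-- The `r`-colored permutations `(σ, c)` of size `n`. -/
abbrev ColoredPerm (r n : ℕ) : Type := Equiv.Perm (Fin n) × (Fin n → Fin r)

/-- The descent number of a permutation of size `n + 1`. -/
def permDes {n : ℕ} (σ : Equiv.Perm (Fin (n + 1))) : ℕ :=
  (Finset.univ.filter fun i : Fin n => σ i.castSucc > σ i.succ).card

/-- The descent number of a colored permutation of size `n + 1`: the number of `i` such that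
`cᵢ > cᵢ₊₁`, or `cᵢ = cᵢ₊₁` and `σᵢ > σᵢ₊₁`. -/
def coloredDes {r n : ℕ} (p : ColoredPerm r (n + 1)) : ℕ :=
  (Finset.univ.filter fun i : Fin n =>
    p.2 i.castSucc > p.2 i.succ ∨
      (p.2 i.castSucc = p.2 i.succ ∧ p.1 i.castSucc > p.1 i.succ)).card

/-- The flag descent number `r * des(σ, c) + (the last color)`. -/
def flagDes {r n : ℕ} (p : ColoredPerm r (n + 1)) : ℕ :=
  r * coloredDes p + (p.2 (Fin.last n) : ℕ)

/-! ### Formal power series in the three variables `x`, `y`, `z` -/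

/-- The ring `ℚ⟦z⟧⟦y⟧⟦x⟧` of formal power series in `x`, `y`, `z`. It carries the topology of
coefficientwise convergence. -/
abbrev SeriesXYZ : Type := PowerSeries (PowerSeries (PowerSeries ℚ))

/-- The variable `x`. -/
def varX : SeriesXYZ := PowerSeries.X

/-- The variable `y`. -/
def varY : SeriesXYZ := PowerSeries.C PowerSeries.X

/-- The variable `z`. -/
def varZ : SeriesXYZ := PowerSeries.C (PowerSeries.C PowerSeries.X)

/-- The ordinary generating function `∑_{n ≥ 0} A_n^{(r)}(y, z) x^n`. -/
def biEulerianOGF (r : ℕ) : SeriesXYZ :=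
  PowerSeries.mk fun n => (biEulerian r n : PowerSeries (PowerSeries ℚ))

/-- The term `z^m (1 - y (1 / (1 - x (1 - y^r) (1 - z)))^m)⁻¹`.  Both series that are inverted have
constant term `1`, hence are units, so that `Ring.inverse` is their genuine inverse. -/
def ogfTerm (r m : ℕ) : SeriesXYZ :=
  varZ ^ m * Ring.inverse
    (1 - varY * Ring.inverse (1 - varX * (1 - varY ^ r) * (1 - varZ)) ^ m)

end

/-! ### Multiset coefficients -/

/-! Everything passes through the double series `M_n = ∑_{j,t} multichoose (j t) n y^j z^t`.

Ehrhart side: the points of `[0, rt)^n ∩ ℤ^n`, graded by coordinate sum, have generating function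
`(1 - q^(rt))^n / (1 - q)^n`. Counting points with sum below `j t` and recording this at `y^j` turns
`q^(rt)` into `y^r` and `1/(1-q)^n` into `∑_j multichoose (j t) n y^j`; a factor `1 - y` then
isolates the slices. Hence, for `n ≥ 1`, `A_n = (1-z)^(n+1) (1-y) (1-y^r)^n M_n` (`coe_biEulerian`).

Generating function: the sum over `n` of `multichoose (j m) n w^n x^n` is `(1 - x w)^(-j m)`, so the
sum over `j` is geometric; take `w = (1-y^r)(1-z)` (`one_sub_mul_multichooseOGF`).

Permutation side: `multichoose (j t) n` counts weakly increasing words in the lexicographic product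
of chains of sizes `j` and `t`. Classifying them by the permutation that stably sorts second
coordinates expresses `(1-y)^(n+1) (1-z)^(n+1) M_n` through descents of `σ` and `σ⁻¹`
(`card_monotone_sort_fiber`, `mul_multichooseSeries_eq_sum_perm`). Summing over colors multiplies
the `σ` term by `(1 + y + ⋯ + y^(r-1))^n` (`sum_flagDes`), which converts `(1-y)^n` into
`(1-y^r)^n`. -/

theorem mk_one_pow_eq_mk_multichoose (S : Type*) [CommRing S] (m : ℕ) :
    (PowerSeries.mk 1 : PowerSeries S) ^ m =
      PowerSeries.mk fun n => (Nat.multichoose m n : S) := by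
  cases m with
  | zero =>
    ext n
    cases n <;> simp [PowerSeries.coeff_one]
  | succ d =>
    rw [PowerSeries.mk_one_pow_eq_mk_choose_add]
    ext n
    rw [PowerSeries.coeff_mk, PowerSeries.coeff_mk, Nat.multichoose_eq,
      show d + 1 + n - 1 = d + n by omega, Nat.choose_symm_add]

theorem multichoose_zero_left (n : ℕ) : Nat.multichoose 0 n = if n = 0 then 1 else 0 := by
  cases n <;> simp

/-- Vandermonde's identity for multiset coefficients. -/
theorem sum_antidiagonal_multichoose (a b n : ℕ) :
    ∑ p ∈ Finset.HasAntidiagonal.antidiagonal n, Nat.multichoose a p.1 * Nat.multichoose b p.2 =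
      Nat.multichoose (a + b) n := by
  have h := congrArg (PowerSeries.coeff n) (pow_add (PowerSeries.mk 1 : PowerSeries ℤ) a b)
  rw [mk_one_pow_eq_mk_multichoose, mk_one_pow_eq_mk_multichoose, mk_one_pow_eq_mk_multichoose,
    PowerSeries.coeff_mul] at h
  simp only [PowerSeries.coeff_mk] at h
  exact_mod_cast h.symm

/-- Hockey-stick summation; truncated subtraction kills the terms with `v < e`. It drives the
induction on length in `card_gapChains`. -/
theorem sum_range_multichoose_succ_sub (e j n : ℕ) :
    ∑ v ∈ Finset.range j, Nat.multichoose (v + 1 - e) (n + 1) =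
      Nat.multichoose (j - e) (n + 2) := by
  induction j with
  | zero => simp
  | succ j ih =>
    rw [Finset.sum_range_succ, ih]
    rcases le_or_gt e j with h | h
    · rw [show j + 1 - e = j - e + 1 by omega, Nat.multichoose_succ_succ (j - e) (n + 1)]
    · rw [show j + 1 - e = 0 by omega, show j - e = 0 by omega]
      simp

/-- Both sides are the same hockey-stick binomial. Positivity of `n` is needed at `j = 0`, where `n
= 0` would give `0 = 1`. -/
theorem sum_range_multichoose_symm (n j : ℕ) (hn : 0 < n) :
    ∑ m ∈ Finset.range j, Nat.multichoose n m = Nat.multichoose j n := by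
  cases j with
  | zero =>
    obtain ⟨k, rfl⟩ := Nat.exists_eq_succ_of_ne_zero hn.ne'
    simp
  | succ j =>
    rw [Nat.sum_range_multichoose, Nat.multichoose_eq, show j + 1 + n - 1 = j + n by omega]

/-- The coefficients vanish for `j ≤ d`, not just `j < d`; this is the source of the `+ 1` in the
exponents `des + 1`. -/
theorem one_sub_X_pow_mul_mk_multichoose_sub (S : Type*) [CommRing S] (d n : ℕ) :
    (1 - PowerSeries.X) ^ (n + 2) *
      (PowerSeries.mk fun j => (Nat.multichoose (j - d) (n + 1) : S)) =
      PowerSeries.X ^ (d + 1) := by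
  have h : (PowerSeries.mk fun j => (Nat.multichoose (j - d) (n + 1) : S)) =
      PowerSeries.X ^ (d + 1) * PowerSeries.mk 1 ^ (n + 2) := by
    rw [mk_one_pow_eq_mk_multichoose]
    ext j
    rw [PowerSeries.coeff_X_pow_mul']
    simp only [PowerSeries.coeff_mk]
    split_ifs with hj
    · obtain ⟨k, rfl⟩ := Nat.exists_eq_add_of_le hj
      rw [Nat.multichoose_eq, Nat.multichoose_eq, show d + 1 + k - d + (n + 1) - 1 = n + 1 + k by
        omega, show d + 1 + k - (d + 1) = k by omega, show n + 2 + k - 1 = n + 1 + k by omega,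
        Nat.choose_symm_add]
    · rw [show j - d = 0 by omega]
      simp
  have h1 : (1 - PowerSeries.X : PowerSeries S) ^ (n + 2) * PowerSeries.mk 1 ^ (n + 2) = 1 := by
    rw [← mul_pow, mul_comm, PowerSeries.mk_one_mul_one_sub_eq_one, one_pow]
  rw [h, mul_left_comm, h1, mul_one]

/-! ### Lattice points of the slices -/

/-- The linear map sending `∑ f_m q^m` to `∑_j (∑_{m < j t} f_m) y^j`. -/
noncomputable def blockSum (t : ℕ) : PowerSeries ℚ →ₗ[ℚ] PowerSeries ℚ where
  toFun f := PowerSeries.mk fun j => ∑ m ∈ Finset.range (j * t), PowerSeries.coeff m f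
  map_add' f g := by
    ext j
    simp [Finset.sum_add_distrib]
  map_smul' c f := by
    ext j
    simp [Finset.mul_sum]

theorem coeff_blockSum (t j : ℕ) (f : PowerSeries ℚ) :
    PowerSeries.coeff j (blockSum t f) =
      ∑ m ∈ Finset.range (j * t), PowerSeries.coeff m f := by
  simp [blockSum]

/-- A shift by `r` whole blocks of length `t` shifts the partial sums at block ends by `r`. -/
theorem blockSum_X_pow_mul (t r : ℕ) (f : PowerSeries ℚ) :
    blockSum t (PowerSeries.X ^ (r * t) * f) = PowerSeries.X ^ r * blockSum t f := by
  ext j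
  rw [coeff_blockSum, PowerSeries.coeff_X_pow_mul']
  simp only [PowerSeries.coeff_X_pow_mul']
  split_ifs with h
  · obtain ⟨k, rfl⟩ := Nat.exists_eq_add_of_le h
    rw [coeff_blockSum, add_mul, Finset.sum_range_add, Nat.add_sub_cancel_left,
      Finset.sum_eq_zero, zero_add]
    · exact Finset.sum_congr rfl fun i _ => by simp
    · intro i hi
      rw [if_neg (by simpa using hi)]
  · refine Finset.sum_eq_zero fun i hi => if_neg ?_
    have h1 : i < j * t := by simpa using hi
    have h2 : j * t ≤ r * t := Nat.mul_le_mul_right t (by omega)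
    omega

theorem blockSum_one_sub_X_pow_pow_mul (t r n : ℕ) (f : PowerSeries ℚ) :
    blockSum t ((1 - PowerSeries.X ^ (r * t)) ^ n * f) =
      (1 - PowerSeries.X ^ r) ^ n * blockSum t f := by
  induction n with
  | zero => simp
  | succ n ih =>
    rw [pow_succ', mul_assoc, sub_mul, one_mul, map_sub, blockSum_X_pow_mul, ih]
    ring

theorem blockSum_mk_one_pow (t n : ℕ) (hn : 0 < n) :
    blockSum t (PowerSeries.mk 1 ^ n) =
      PowerSeries.mk fun j => (Nat.multichoose (j * t) n : ℚ) := by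
  ext j
  rw [coeff_blockSum, mk_one_pow_eq_mk_multichoose, PowerSeries.coeff_mk,
    ← sum_range_multichoose_symm n (j * t) hn]
  simp

/-- The lattice points of the half-open cube `[0, s)ⁿ`. -/
def boxPoints (s n : ℕ) : Finset (Fin n → ℕ) := Fintype.piFinset fun _ => Finset.range s

theorem mem_boxPoints {s n : ℕ} {p : Fin n → ℕ} : p ∈ boxPoints s n ↔ ∀ i, p i < s := by
  simp [boxPoints]

theorem sum_boxPoints_X_pow (s n : ℕ) :
    ∑ p ∈ boxPoints s n, (PowerSeries.X : PowerSeries ℚ) ^ (∑ i, p i) =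
      (1 - PowerSeries.X ^ s) ^ n * PowerSeries.mk 1 ^ n := by
  have h : (∑ a ∈ Finset.range s, (PowerSeries.X : PowerSeries ℚ) ^ a) =
      (1 - PowerSeries.X ^ s) * PowerSeries.mk 1 := by
    rw [← geom_sum_mul_neg, mul_assoc, mul_comm _ (PowerSeries.mk 1),
      PowerSeries.mk_one_mul_one_sub_eq_one, mul_one]
  rw [← mul_pow, ← h, ← Fin.prod_const, Finset.prod_univ_sum]
  exact Finset.sum_congr rfl fun p _ => (Finset.prod_pow_eq_pow_sum _ _ _).symm

theorem coeff_blockSum_sum_boxPoints (t s n j : ℕ) :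
    PowerSeries.coeff j
        (blockSum t (∑ p ∈ boxPoints s n, (PowerSeries.X : PowerSeries ℚ) ^ (∑ i, p i))) =
      (((boxPoints s n).filter fun p => ∑ i, p i < j * t).card : ℚ) := by
  rw [coeff_blockSum]
  simp only [map_sum, PowerSeries.coeff_X_pow]
  rw [Finset.sum_comm, Finset.card_filter, Nat.cast_sum]
  refine Finset.sum_congr rfl fun p _ => ?_
  rw [Finset.sum_ite_eq' ]
  simp

theorem coeff_succ_one_sub_X_mul {S : Type*} [CommRing S] (k : ℕ) (f : PowerSeries S) :
    PowerSeries.coeff (k + 1) ((1 - PowerSeries.X) * f) =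
      PowerSeries.coeff (k + 1) f - PowerSeries.coeff k f := by
  rw [sub_mul, one_mul, map_sub, PowerSeries.coeff_succ_X_mul]

/-- A slice is the difference of two consecutive cumulative counts, and multiplication by `1 - y`
takes that difference. -/
theorem card_boxPoints_slice (t s n k : ℕ) :
    (((boxPoints s n).filter fun p => k * t ≤ ∑ i, p i ∧ ∑ i, p i < (k + 1) * t).card : ℚ) =
      PowerSeries.coeff (k + 1) ((1 - PowerSeries.X) *
        blockSum t (∑ p ∈ boxPoints s n, (PowerSeries.X : PowerSeries ℚ) ^ (∑ i, p i))) := by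
  rw [coeff_succ_one_sub_X_mul, coeff_blockSum_sum_boxPoints, coeff_blockSum_sum_boxPoints,
    eq_sub_iff_add_eq, ← Nat.cast_add, ← Finset.card_union_of_disjoint]
  · congr 2
    ext p
    have : k * t ≤ (k + 1) * t := Nat.mul_le_mul_right t (by omega)
    simp only [Finset.mem_union, Finset.mem_filter]
    constructor
    · rintro (⟨h, -, h'⟩ | ⟨h, h'⟩)
      · exact ⟨h, h'⟩
      · exact ⟨h, by omega⟩
    · rintro ⟨h, h'⟩
      by_cases h2 : k * t ≤ ∑ i, p i
      · exact Or.inl ⟨h, h2, h'⟩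
      · exact Or.inr ⟨h, by omega⟩
  · rw [Finset.disjoint_left]
    intro p hp hp'
    simp only [Finset.mem_filter] at hp hp'
    omega

theorem latticeCount_halfOpenSlice (r n k t : ℕ) (ht : 0 < t) :
    latticeCount (halfOpenSlice r n (k + 1)) t =
      ((boxPoints (r * t) n).filter fun p => k * t ≤ ∑ i, p i ∧ ∑ i, p i < (k + 1) * t).card := by
  have ht' : (0 : ℝ) < t := Nat.cast_pos.mpr ht
  have hmem : ∀ p : Fin n → ℤ, ((fun i => (p i : ℝ)) ∈ (t : ℝ) • halfOpenSlice r n (k + 1)) ↔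
      (∀ i, 0 ≤ p i ∧ p i < (r * t : ℕ)) ∧
        ((k * t : ℕ) : ℤ) ≤ ∑ i, p i ∧ ∑ i, p i < ((k + 1) * t : ℕ) := by
    intro p
    rw [Set.mem_smul_set_iff_inv_smul_mem₀ ht'.ne']
    simp only [halfOpenSlice, Set.mem_ofPred_eq, Pi.smul_apply, smul_eq_mul, ← Finset.mul_sum]
    refine and_congr (forall_congr' fun i => and_congr ?_ ?_) (and_congr ?_ ?_)
    · rw [mul_nonneg_iff_of_pos_left (inv_pos.mpr ht')]
      exact_mod_cast Iff.rfl
    · rw [inv_mul_lt_iff₀ ht', mul_comm]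
      exact_mod_cast Iff.rfl
    · rw [le_inv_mul_iff₀ ht', mul_comm, Nat.cast_add_one, add_sub_cancel_right]
      exact_mod_cast Iff.rfl
    · rw [inv_mul_lt_iff₀ ht', mul_comm]
      exact_mod_cast Iff.rfl
  rw [latticeCount, ← Set.ncard_coe_finset,
    ← Set.ncard_image_of_injective (f := fun (p : Fin n → ℕ) i => (p i : ℤ))]
  · congr 1
    ext p
    rw [Set.mem_ofPred_eq, hmem]
    simp only [Set.mem_image, Finset.mem_coe, Finset.mem_filter, mem_boxPoints]
    constructor
    · rintro ⟨h, h1, h2⟩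
      have hp : ∀ i, ((p i).toNat : ℤ) = p i := fun i => Int.toNat_of_nonneg (h i).1
      refine ⟨fun i => (p i).toNat, ⟨fun i => ?_, ?_, ?_⟩, funext hp⟩
      · have := (h i).2
        rw [← hp i] at this
        exact_mod_cast this
      · rw [← Finset.sum_congr rfl fun i _ => hp i] at h1
        exact_mod_cast h1
      · rw [← Finset.sum_congr rfl fun i _ => hp i] at h2
        exact_mod_cast h2
    · rintro ⟨q, ⟨h, h1, h2⟩, rfl⟩
      beta_reduce
      exact ⟨fun i => ⟨Int.natCast_nonneg _, by exact_mod_cast h i⟩, by exact_mod_cast h1,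
        by exact_mod_cast h2⟩
  · intro p q h
    ext i
    exact Int.ofNat_injective (congrFun h i)

/-! ### The Ehrhart polynomials of the slices -/

/-- The polynomial `t ↦ multichoose (j t) n`. -/
noncomputable def multichoosePoly (n j : ℕ) : Polynomial ℚ :=
  Polynomial.C ((n.factorial : ℚ)⁻¹) *
    (ascPochhammer ℚ n).comp (Polynomial.C (j : ℚ) * Polynomial.X)

theorem eval_multichoosePoly (n j t : ℕ) :
    (multichoosePoly n j).eval (t : ℚ) = (Nat.multichoose (j * t) n : ℚ) := by
  have h : (ascPochhammer ℚ n).eval ((j * t : ℕ) : ℚ) =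
      n.factorial * (Nat.multichoose (j * t) n : ℚ) := by
    rw [← ascPochhammer_eval_cast, ascPochhammer_nat_eq_ascFactorial, Nat.multichoose_eq,
      Nat.ascFactorial_eq_factorial_mul_choose', Nat.cast_mul]
  rw [multichoosePoly, Polynomial.eval_mul, Polynomial.eval_C, Polynomial.eval_comp,
    Polynomial.eval_mul, Polynomial.eval_C, Polynomial.eval_X, ← Nat.cast_mul, h,
    inv_mul_cancel_left₀ (Nat.cast_ne_zero.mpr n.factorial_ne_zero)]

/-- The polynomial whose value at `t` is the coefficient of `y^k` in
`(1 - y) (1 - y^r)^n ∑_j multichoose (j t) n y^j`. -/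
noncomputable def slicePoly (r n k : ℕ) : Polynomial ℚ :=
  PowerSeries.coeff k ((1 - PowerSeries.X) * ((1 - PowerSeries.X ^ r) ^ n *
    PowerSeries.mk (multichoosePoly n)))

theorem eval_slicePoly (r n k t : ℕ) :
    (slicePoly r n k).eval (t : ℚ) =
      PowerSeries.coeff k ((1 - PowerSeries.X) * ((1 - PowerSeries.X ^ r) ^ n *
        PowerSeries.mk fun j => (Nat.multichoose (j * t) n : ℚ))) := by
  rw [slicePoly, ← Polynomial.coe_evalRingHom, ← PowerSeries.coeff_map]
  congr 1
  simp only [map_mul, map_sub, map_one, map_pow, PowerSeries.map_X]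
  congr 2
  ext j
  simp [eval_multichoosePoly]

theorem isEhrhartPolynomial_slicePoly (r n k : ℕ) (hn : 0 < n) :
    IsEhrhartPolynomial (halfOpenSlice r n (k + 1)) (slicePoly r n (k + 1)) := by
  intro t ht
  rw [latticeCount_halfOpenSlice r n k t ht, card_boxPoints_slice, eval_slicePoly,
    sum_boxPoints_X_pow, blockSum_one_sub_X_pow_pow_mul, blockSum_mk_one_pow t n hn]

theorem IsEhrhartPolynomial.ehrhartPolynomial_eq {n : ℕ} {P : Set (Fin n → ℝ)}
    {E : Polynomial ℚ} (hE : IsEhrhartPolynomial P E) : ehrhartPolynomial P = E := by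
  have h : ∃ E : Polynomial ℚ, IsEhrhartPolynomial P E := ⟨E, hE⟩
  rw [ehrhartPolynomial, dif_pos h]
  exact h.choose_spec.unique hE

/-- Coordinate sums in `[0, rt)^n` stay below `r n t`, so these slices are empty and uniqueness
forces the zero polynomial. Thus the convention for `k > r n` agrees with the closed form. -/
theorem slicePoly_eq_zero (r n k : ℕ) (hn : 0 < n) (hk : r * n ≤ k) :
    slicePoly r n (k + 1) = 0 := by
  refine (isEhrhartPolynomial_slicePoly r n k hn).unique fun t ht => ?_
  rw [latticeCount_halfOpenSlice r n k t ht, Finset.filter_false_of_mem]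
  · simp
  · rintro p hp ⟨h, -⟩
    rw [mem_boxPoints] at hp
    have : Nonempty (Fin n) := ⟨⟨0, hn⟩⟩
    have h1 : ∑ i, p i < ∑ _i : Fin n, r * t :=
      Finset.sum_lt_sum_of_nonempty Finset.univ_nonempty fun i _ => hp i
    rw [Finset.sum_const, Finset.card_univ, Fintype.card_fin, smul_eq_mul] at h1
    have h2 : r * n * t ≤ k * t := Nat.mul_le_mul_right t hk
    have h3 : n * (r * t) = r * n * t := by ring
    omega

theorem slicePoly_zero (r n : ℕ) (hn : 0 < n) : slicePoly r n 0 = 0 := by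
  have h : multichoosePoly n 0 = 0 := by
    refine Polynomial.eq_of_infinite_eval_eq _ _ (Set.Infinite.mono ?_
      (Set.infinite_range_of_injective (Nat.cast_injective (R := ℚ))))
    rintro _ ⟨t, rfl⟩
    obtain ⟨m, rfl⟩ := Nat.exists_eq_succ_of_ne_zero hn.ne'
    simp [eval_multichoosePoly]
  simp [slicePoly, h]

theorem biEulerianCoeff_eq (r n k : ℕ) (hn : 0 < n) :
    (if k ≤ r * n then biEulerianCoeff r n k else 0) = (1 - PowerSeries.X) ^ (n + 1) *
      PowerSeries.mk fun t : ℕ => (slicePoly r n k).eval (t : ℚ) := by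
  cases k with
  | zero =>
    have : (PowerSeries.mk fun _ => 0 : PowerSeries ℚ) = 0 := by ext; simp
    simp [biEulerianCoeff, hn.ne', slicePoly_zero r n hn, this]
  | succ k =>
    split_ifs with h
    · rw [biEulerianCoeff, if_neg k.succ_ne_zero, if_pos h, ehrhartSeries,
        (isEhrhartPolynomial_slicePoly r n k hn).ehrhartPolynomial_eq]
    · have : (PowerSeries.mk fun _ => 0 : PowerSeries ℚ) = 0 := by ext; simp
      simp [slicePoly_eq_zero r n k hn (by omega), this]

/-- The series `∑_{j, t} multichoose (j t) n y^j z^t`. -/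
noncomputable def multichooseSeries (n : ℕ) : PowerSeries (PowerSeries ℚ) :=
  PowerSeries.mk fun j => PowerSeries.mk fun t => (Nat.multichoose (j * t) n : ℚ)

theorem coe_biEulerian_eq (r n : ℕ) :
    (biEulerian r n : PowerSeries (PowerSeries ℚ)) =
      PowerSeries.mk fun k => if k ≤ r * n then biEulerianCoeff r n k else 0 := by
  ext1 k
  rw [Polynomial.coeff_coe, biEulerian, PowerSeries.coeff_mk]
  simp [Polynomial.finsetSum_coeff]

/-- The factor `P` does not involve `z`, so it acts on each power of `z` separately. -/
theorem coeff_coeff_map_C_mul (P : PowerSeries ℚ) (F : PowerSeries (PowerSeries ℚ)) (k t : ℕ) :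
    PowerSeries.coeff t (PowerSeries.coeff k (PowerSeries.map PowerSeries.C P * F)) =
      PowerSeries.coeff k
        (P * PowerSeries.mk fun j => PowerSeries.coeff t (PowerSeries.coeff j F)) := by
  simp only [PowerSeries.coeff_mul k, map_sum, PowerSeries.coeff_map, PowerSeries.coeff_C_mul,
    PowerSeries.coeff_mk]

/-- The closed form of the generating polynomial of the Ehrhart series. -/
theorem coe_biEulerian (r n : ℕ) (hn : 0 < n) :
    (biEulerian r n : PowerSeries (PowerSeries ℚ)) =
      PowerSeries.C ((1 - PowerSeries.X) ^ (n + 1)) *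
        ((1 - PowerSeries.X) * (1 - PowerSeries.X ^ r) ^ n * multichooseSeries n) := by
  rw [coe_biEulerian_eq]
  ext1 k
  rw [PowerSeries.coeff_mk, biEulerianCoeff_eq r n k hn, PowerSeries.coeff_C_mul]
  congr 1
  ext t
  have h := coeff_coeff_map_C_mul ((1 - PowerSeries.X) * (1 - PowerSeries.X ^ r) ^ n)
    (multichooseSeries n) k t
  simp only [map_mul, map_sub, map_one, map_pow, PowerSeries.map_X] at h
  rw [h, PowerSeries.coeff_mk, eval_slicePoly, mul_assoc]
  simp [multichooseSeries]

/-! ### The ordinary generating function -/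

theorem Ring.inverse_eq_of_mul_eq_one {S : Type*} [CommRing S] {a b : S} (h : a * b = 1) :
    Ring.inverse a = b :=
  Ring.inverse_unit (Units.mkOfMulEqOne a b h)

/-- The series `∑_n (∑_j multichoose (j m) n y^j) w^n x^n`. -/
noncomputable def multichooseOGF {S : Type*} [CommRing S] (w : PowerSeries S) (m : ℕ) :
    PowerSeries (PowerSeries S) :=
  PowerSeries.mk fun n => w ^ n * PowerSeries.mk fun j => (Nat.multichoose (j * m) n : S)

theorem rescale_mk_one_pow {S : Type*} [CommRing S] (w : S) (m : ℕ) :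
    PowerSeries.rescale w (PowerSeries.mk 1) ^ m =
      PowerSeries.mk fun n => w ^ n * (Nat.multichoose m n : S) := by
  rw [← map_pow, mk_one_pow_eq_mk_multichoose]
  ext n
  rw [PowerSeries.coeff_rescale, PowerSeries.coeff_mk, PowerSeries.coeff_mk]

theorem inverse_one_sub_X_mul_C {S : Type*} [CommRing S] (w : S) :
    Ring.inverse (1 - PowerSeries.X * PowerSeries.C w) =
      PowerSeries.rescale w (PowerSeries.mk 1) := by
  refine Ring.inverse_eq_of_mul_eq_one ?_
  have h := congrArg (PowerSeries.rescale w) (PowerSeries.mk_one_mul_one_sub_eq_one S)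
  rwa [map_mul, map_sub, map_one, PowerSeries.rescale_X, mul_comm, mul_comm (PowerSeries.C w)] at h

/-- With `u = 1/(1 - x w)`, the series is `∑_j y^j u^(j m)` regrouped by powers of `x`.
Multiplication by `u^m` replaces `j` by `j + 1` (Vandermonde), so the product telescopes to the term
`j = 0`. -/
theorem one_sub_mul_multichooseOGF {S : Type*} [CommRing S] (w : PowerSeries S) (m : ℕ) :
    (1 - PowerSeries.C PowerSeries.X * PowerSeries.rescale w (PowerSeries.mk 1) ^ m) *
      multichooseOGF w m = 1 := by
  have hmul : ∀ n, PowerSeries.coeff n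
      (PowerSeries.rescale w (PowerSeries.mk 1) ^ m * multichooseOGF w m) =
      w ^ n * PowerSeries.mk fun j => (Nat.multichoose ((j + 1) * m) n : S) := by
    intro n
    rw [rescale_mk_one_pow, multichooseOGF, PowerSeries.coeff_mul]
    have : ∀ p ∈ Finset.HasAntidiagonal.antidiagonal n,
        PowerSeries.coeff p.1
            (PowerSeries.mk fun n => w ^ n * (Nat.multichoose m n : PowerSeries S)) *
          PowerSeries.coeff p.2 (PowerSeries.mk fun n =>
            w ^ n * PowerSeries.mk fun j => (Nat.multichoose (j * m) n : S)) =
        w ^ n * ((Nat.multichoose m p.1 : PowerSeries S) *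
          PowerSeries.mk fun j => (Nat.multichoose (j * m) p.2 : S)) := by
      intro p hp
      rw [PowerSeries.coeff_mk, PowerSeries.coeff_mk, ← Finset.HasAntidiagonal.mem_antidiagonal.mp hp]
      ring
    rw [Finset.sum_congr rfl this, ← Finset.mul_sum]
    congr 1
    ext j
    rw [map_sum, PowerSeries.coeff_mk, show (j + 1) * m = m + j * m by ring,
      ← sum_antidiagonal_multichoose, Nat.cast_sum]
    refine Finset.sum_congr rfl fun p _ => ?_
    rw [← map_natCast (PowerSeries.C (R := S)), PowerSeries.coeff_C_mul, PowerSeries.coeff_mk,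
      Nat.cast_mul]
  ext n j
  rw [sub_mul, one_mul, mul_assoc, map_sub, PowerSeries.coeff_C_mul, hmul, mul_left_comm,
    multichooseOGF, PowerSeries.coeff_mk, ← mul_sub]
  have h : (PowerSeries.mk fun j => (Nat.multichoose (j * m) n : S)) -
      PowerSeries.X * (PowerSeries.mk fun j => (Nat.multichoose ((j + 1) * m) n : S)) =
      if n = 0 then 1 else 0 := by
    ext i
    cases i with
    | zero => split_ifs with h <;> simp [multichoose_zero_left, h]
    | succ i =>
      rw [map_sub, PowerSeries.coeff_succ_X_mul]
      split_ifs with h <;> simp [PowerSeries.coeff_one]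
  rw [h, PowerSeries.coeff_one]
  split_ifs with h0 <;> simp [h0]

/-- The factor `(1 - y^r) (1 - z)`. -/
noncomputable def weightYZ (r : ℕ) : PowerSeries (PowerSeries ℚ) :=
  (1 - PowerSeries.X ^ r) * PowerSeries.C (1 - PowerSeries.X)

theorem ogfTerm_eq (r m : ℕ) : ogfTerm r m = varZ ^ m * multichooseOGF (weightYZ r) m := by
  have h : (1 : SeriesXYZ) - varX * (1 - varY ^ r) * (1 - varZ) =
      1 - PowerSeries.X * PowerSeries.C (weightYZ r) := by
    simp only [varX, varY, varZ, weightYZ, map_mul, map_sub, map_one, map_pow]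
    ring
  rw [ogfTerm, h, inverse_one_sub_X_mul_C, varY,
    Ring.inverse_eq_of_mul_eq_one (one_sub_mul_multichooseOGF (weightYZ r) m)]

theorem hasSum_multichooseSeries (n : ℕ) :
    HasSum (fun m : ℕ => PowerSeries.C (PowerSeries.X ^ m : PowerSeries ℚ) *
      PowerSeries.mk fun j => (Nat.multichoose (j * m) n : PowerSeries ℚ))
      (multichooseSeries n) := by
  rw [PowerSeries.WithPiTopology.hasSum_iff_hasSum_coeff]
  intro j
  have h := PowerSeries.hasSum_of_monomials_self
    (PowerSeries.mk fun t => (Nat.multichoose (j * t) n : ℚ))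
  rw [multichooseSeries, PowerSeries.coeff_mk]
  refine (congrArg (HasSum · _) (funext fun m => ?_)).mpr h
  rw [PowerSeries.coeff_C_mul, PowerSeries.coeff_mk, PowerSeries.coeff_mk,
    PowerSeries.monomial_eq_C_mul_X_pow, map_natCast, mul_comm]

theorem hasSum_ogfTerm (r : ℕ) :
    HasSum (ogfTerm r) (PowerSeries.mk fun n => weightYZ r ^ n * multichooseSeries n) := by
  rw [PowerSeries.WithPiTopology.hasSum_iff_hasSum_coeff]
  intro n
  rw [PowerSeries.coeff_mk]
  refine (congrArg (HasSum · _) (funext fun m => ?_)).mpr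
    ((hasSum_multichooseSeries n).mul_left (weightYZ r ^ n))
  rw [ogfTerm_eq, varZ, ← map_pow, ← map_pow, PowerSeries.coeff_C_mul, multichooseOGF,
    PowerSeries.coeff_mk, mul_left_comm]

theorem biEulerian_zero (r : ℕ) : biEulerian r 0 = 1 := by
  simp [biEulerian, biEulerianCoeff]

theorem biEulerianOGF_eq (r : ℕ) :
    biEulerianOGF r = (1 - varY) * (1 - varZ) *
      PowerSeries.mk fun n => weightYZ r ^ n * multichooseSeries n := by
  have h : (1 - varY) * (1 - varZ) = PowerSeries.C
      ((1 - PowerSeries.X) * PowerSeries.C (1 - PowerSeries.X) : PowerSeries (PowerSeries ℚ)) := by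
    simp only [varY, varZ, map_mul, map_sub, map_one]
  rw [h]
  ext1 n
  rw [PowerSeries.coeff_C_mul, PowerSeries.coeff_mk, biEulerianOGF, PowerSeries.coeff_mk]
  rcases Nat.eq_zero_or_pos n with rfl | hn
  -- The closed form requires `n > 0`; for `n = 0` all coefficients of the double series are `1`, so
  -- it is `1/((1-y)(1-z))`.
  · have h1 : multichooseSeries 0 = PowerSeries.mk 1 * PowerSeries.C (PowerSeries.mk 1) := by
      ext j t
      rw [PowerSeries.coeff_mul_C]
      simp [multichooseSeries]
    have h2 : PowerSeries.C (1 - PowerSeries.X : PowerSeries ℚ) *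
        PowerSeries.C (PowerSeries.mk 1) = (1 : PowerSeries (PowerSeries ℚ)) := by
      rw [← map_mul, mul_comm, PowerSeries.mk_one_mul_one_sub_eq_one, map_one]
    rw [biEulerian_zero, pow_zero, one_mul, h1, mul_mul_mul_comm, h2,
      mul_comm _ (PowerSeries.mk 1), PowerSeries.mk_one_mul_one_sub_eq_one, mul_one,
      Polynomial.coe_one]
  · rw [coe_biEulerian r n hn, weightYZ, map_pow, mul_pow]
    ring

/-! ### Chains with prescribed gaps -/

/-- The sequences of natural numbers less than `j` whose consecutive gaps are at least `δ`. -/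
def gapChains {n : ℕ} (δ : Fin n → ℕ) (j : ℕ) : Finset (Fin (n + 1) → ℕ) :=
  (boxPoints j (n + 1)).filter fun a => ∀ i : Fin n, a i.castSucc + δ i ≤ a i.succ

theorem mem_gapChains {n : ℕ} {δ : Fin n → ℕ} {j : ℕ} {a : Fin (n + 1) → ℕ} :
    a ∈ gapChains δ j ↔
      a (Fin.last n) < j ∧ ∀ i : Fin n, a i.castSucc + δ i ≤ a i.succ := by
  rw [gapChains, Finset.mem_filter, mem_boxPoints]
  refine ⟨fun h => ⟨h.1 _, h.2⟩, fun h => ⟨fun i => ?_, h.2⟩⟩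
  have hmono : Monotone a :=
    Fin.monotone_iff_le_succ.mpr fun i => (Nat.le_add_right _ _).trans (h.2 i)
  exact (hmono (Fin.le_last i)).trans_lt h.1

/-- Subtracting the accumulated gaps leaves a weakly increasing word. The induction fixes the last
value `v`: the rest is a chain bounded by `v + 1 - δ_last`, and truncation to `0` correctly leaves
no chain when `v < δ_last`. -/
theorem card_gapChains {n : ℕ} (δ : Fin n → ℕ) (j : ℕ) :
    (gapChains δ j).card = Nat.multichoose (j - ∑ i, δ i) (n + 1) := by
  induction n generalizing j with
  | zero => simp [gapChains, boxPoints]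
  | succ n ih =>
    have hfib : ∀ v ∈ Finset.range j,
        ((gapChains δ j).filter fun a => a (Fin.last (n + 1)) = v).card =
          (gapChains (fun i : Fin n => δ i.castSucc) (v + 1 - δ (Fin.last n))).card := by
      intro v hv
      rw [Finset.mem_range] at hv
      refine Finset.card_nbij' (fun a => Fin.init a) (fun a => Fin.snoc (α := fun _ => ℕ) a v)
        ?_ ?_ ?_ ?_
      · intro a ha
        rw [Finset.mem_coe, Finset.mem_filter, mem_gapChains] at ha
        obtain ⟨⟨-, h⟩, hl⟩ := ha
        rw [Finset.mem_coe, mem_gapChains]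
        refine ⟨?_, fun i => h i.castSucc⟩
        have h1 := h (Fin.last n)
        rw [Fin.succ_last, hl] at h1
        change a (Fin.last n).castSucc < _
        omega
      · intro a ha
        rw [Finset.mem_coe, mem_gapChains] at ha
        obtain ⟨hl, h⟩ := ha
        rw [Finset.mem_coe, Finset.mem_filter, mem_gapChains]
        refine ⟨⟨by simpa using hv, fun i => ?_⟩, by simp⟩
        beta_reduce
        induction i using Fin.lastCases with
        | last =>
          rw [Fin.succ_last, Fin.snoc_last, Fin.snoc_castSucc]
          omega
        | cast i =>
          rw [← Fin.castSucc_succ, Fin.snoc_castSucc, Fin.snoc_castSucc]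
          exact h i
      · intro a ha
        rw [Finset.mem_coe, Finset.mem_filter] at ha
        rw [← ha.2]
        exact Fin.snoc_init_self a
      · intro a _
        exact Fin.init_snoc (α := fun _ => ℕ) v a
    rw [Finset.card_eq_sum_card_fiberwise (f := fun a => a (Fin.last (n + 1)))
      (t := Finset.range j)]
    · rw [Finset.sum_congr rfl hfib, Fin.sum_univ_castSucc, ← sum_range_multichoose_succ_sub]
      refine Finset.sum_congr rfl fun v _ => ?_
      rw [ih, Nat.sub_sub, add_comm (δ (Fin.last n))]
    · intro a ha
      rw [Finset.mem_coe, mem_gapChains] at ha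
      exact Finset.mem_coe.mpr (Finset.mem_range.mpr ha.1)

open Classical in
theorem card_filter_eq_card_gapChains {n j : ℕ} (δ : Fin n → ℕ) (P : (Fin (n + 1) → Fin j) → Prop)
    (hP : ∀ a, P a ↔ ∀ i : Fin n, (a i.castSucc : ℕ) + δ i ≤ a i.succ) :
    (Finset.univ.filter P).card = (gapChains δ j).card := by
  refine Finset.card_bij (fun a _ i => (a i : ℕ)) ?_ ?_ ?_
  · intro a ha
    exact mem_gapChains.mpr ⟨(a _).isLt, (hP a).mp (Finset.mem_filter.mp ha).2⟩
  · intro a _ b _ h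
    exact funext fun i => Fin.ext (congrFun h i)
  · intro b hb
    refine ⟨fun i => ⟨b i, mem_boxPoints.mp (Finset.mem_filter.mp hb).1 i⟩, ?_, rfl⟩
    exact Finset.mem_filter.mpr ⟨Finset.mem_univ _, (hP _).mpr (mem_gapChains.mp hb).2⟩

open Classical in
theorem card_filter_monotone {α : Type*} [LinearOrder α] [Fintype α] (n : ℕ) :
    (Finset.univ.filter fun g : Fin (n + 1) → α => Monotone g).card =
      Nat.multichoose (Fintype.card α) (n + 1) := by
  have e : Fin (Fintype.card α) ≃o α := Fintype.orderIsoFinOfCardEq α rfl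
  have h := card_filter_eq_card_gapChains (n := n) (j := Fintype.card α) (fun _ => 0)
    (fun a => Monotone a) fun a => by simp [Fin.monotone_iff_le_succ]
  rw [card_gapChains] at h
  simp only [Finset.sum_const_zero, Nat.sub_zero] at h
  rw [← h]
  refine Finset.card_nbij' (fun g => e.symm ∘ g) (fun g => e ∘ g) ?_ ?_ ?_ ?_
  · intro g hg
    simp only [Finset.coe_filter, Finset.mem_univ, true_and, Set.mem_ofPred_eq] at hg ⊢
    exact e.symm.monotone.comp hg
  · intro g hg
    simp only [Finset.coe_filter, Finset.mem_univ, true_and, Set.mem_ofPred_eq] at hg ⊢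
    exact e.monotone.comp hg
  · intro g _
    funext i
    simp
  · intro g _
    funext i
    simp

/-- The words `a` such that `i ↦ (a i, τ i)` is strictly increasing for the lexicographic order. -/
def CompatibleWith {n j : ℕ} (τ : Equiv.Perm (Fin n)) (a : Fin n → Fin j) : Prop :=
  StrictMono fun i => toLex (a i, τ i)

open Classical in
-- Compatibility means weakly increasing, with a strict step exactly forced at each descent of `τ`:
-- gaps `1` there and `0` elsewhere.
theorem card_filter_compatibleWith {n j : ℕ} (τ : Equiv.Perm (Fin (n + 1))) :
    (Finset.univ.filter fun a : Fin (n + 1) → Fin j => CompatibleWith τ a).card =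
      Nat.multichoose (j - permDes τ) (n + 1) := by
  rw [card_filter_eq_card_gapChains
    (fun i : Fin n => if τ i.castSucc > τ i.succ then 1 else 0), card_gapChains, permDes,
    Finset.card_filter]
  intro a
  rw [CompatibleWith, Fin.strictMono_iff_lt_succ]
  refine forall_congr' fun i => ?_
  have hne : τ i.castSucc ≠ τ i.succ := fun h => (Fin.castSucc_lt_succ (i := i)).ne (τ.injective h)
  rw [Prod.Lex.toLex_lt_toLex, Fin.lt_def, Fin.ext_iff]
  dsimp only
  split_ifs with h
  · constructor
    · rintro (h1 | ⟨-, h1⟩)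
      · exact h1
      · exact absurd h1 h.not_gt
    · exact fun h1 => Or.inl h1
  · have h2 : τ i.castSucc < τ i.succ := lt_of_le_of_ne (not_lt.mp h) hne
    simp only [h2, and_true]
    omega

/-! ### The two-sided counting identity -/

open Classical in
-- Keep the first coordinates in place and rearrange the second ones by `τ`. Stability of the sort
-- says ties in the sorted word have increasing `τ`; the lexicographic order says ties among first
-- coordinates have increasing `τ⁻¹`. The two conditions are independent, whence a product.
theorem card_monotone_sort_fiber {n j t : ℕ} (τ : Equiv.Perm (Fin n)) :
    ((Finset.univ.filter fun g : Fin n → Fin j ×ₗ Fin t => Monotone g).filter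
        fun g => Tuple.sort (fun i => (ofLex (g i)).2) = τ).card =
      (Finset.univ.filter fun a : Fin n → Fin j => CompatibleWith τ⁻¹ a).card *
        (Finset.univ.filter fun b : Fin n → Fin t => CompatibleWith τ b).card := by
  rw [← Finset.card_product]
  refine Finset.card_nbij'
    (fun g => (fun i => (ofLex (g i)).1, fun i => (ofLex (g (τ i))).2))
    (fun p i => toLex (p.1 i, p.2 (τ⁻¹ i))) ?_ ?_ ?_ ?_
  · intro g hg
    simp only [Finset.mem_coe, Finset.mem_filter, Finset.mem_univ, true_and] at hg
    obtain ⟨hg, hτ⟩ := hg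
    obtain ⟨hmono, htie⟩ := Tuple.eq_sort_iff.mp hτ.symm
    simp only [Finset.mem_coe, Finset.mem_product, Finset.mem_filter, Finset.mem_univ, true_and]
    constructor
    · intro i k hik
      rw [Prod.Lex.toLex_lt_toLex]
      rcases Prod.Lex.le_iff.mp (hg hik.le) with h | ⟨h, h'⟩
      · exact Or.inl h
      · refine Or.inr ⟨h, ?_⟩
        -- If `k > i` were sorted before `i`, the two second coordinates would be equal, and
        -- stability would give `k < i`.
        by_contra hlt
        have hne : τ⁻¹ k ≠ τ⁻¹ i := fun he => hik.ne' (τ⁻¹.injective he)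
        have hlt' : τ⁻¹ k < τ⁻¹ i := lt_of_le_of_ne (not_lt.mp hlt) hne
        have h1 := hmono hlt'.le
        have h2 := htie _ _ hlt'
        simp only [Function.comp_apply, ← Equiv.Perm.mul_apply, mul_inv_cancel,
          Equiv.Perm.one_apply] at h1 h2
        exact (h2 (le_antisymm h1 h')).not_gt hik
    · intro i k hik
      rw [Prod.Lex.toLex_lt_toLex]
      rcases (hmono hik.le).lt_or_eq with h | h
      · exact Or.inl h
      · exact Or.inr ⟨h, htie _ _ hik h⟩
  · rintro ⟨a, b⟩ hp
    simp only [Finset.mem_coe, Finset.mem_product, Finset.mem_filter, Finset.mem_univ,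
      true_and] at hp
    obtain ⟨ha, hb⟩ := hp
    have hbm : Monotone b := fun i k hik => by
      rcases hik.lt_or_eq with h | h
      · rcases Prod.Lex.toLex_lt_toLex.mp (hb h) with h' | ⟨h', -⟩
        · exact h'.le
        · exact h'.le
      · rw [h]
    simp only [Finset.mem_coe, Finset.mem_filter, Finset.mem_univ, true_and]
    constructor
    · intro i k hik
      rw [Prod.Lex.toLex_le_toLex]
      rcases hik.lt_or_eq with h | rfl
      · rcases Prod.Lex.toLex_lt_toLex.mp (ha h) with h' | ⟨h', h''⟩
        · exact Or.inl h'
        · exact Or.inr ⟨h', hbm h''.le⟩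
      · exact Or.inr ⟨rfl, le_rfl⟩
    · refine (Tuple.eq_sort_iff.mpr ⟨?_, ?_⟩).symm
      · intro i k hik
        simpa using hbm hik
      · intro i k hik h
        simp only [ofLex_toLex, ← Equiv.Perm.mul_apply, inv_mul_cancel, Equiv.Perm.one_apply] at h
        rcases Prod.Lex.toLex_lt_toLex.mp (hb hik) with h' | ⟨-, h'⟩
        · exact absurd h h'.ne
        · exact h'
  · intro g _
    funext i
    simp
  · rintro ⟨a, b⟩ _
    simp

theorem multichoose_mul_eq_sum_perm (j t n : ℕ) :
    Nat.multichoose (j * t) (n + 1) = ∑ τ : Equiv.Perm (Fin (n + 1)),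
      Nat.multichoose (j - permDes τ) (n + 1) * Nat.multichoose (t - permDes τ⁻¹) (n + 1) := by
  classical
  have h := card_filter_monotone (α := Fin j ×ₗ Fin t) n
  rw [Finset.card_eq_sum_card_fiberwise
    (f := fun g : Fin (n + 1) → Fin j ×ₗ Fin t => Tuple.sort fun i => (ofLex (g i)).2)
    (t := Finset.univ) (fun _ _ => Finset.mem_coe.mpr (Finset.mem_univ _))] at h
  have hc : Fintype.card (Fin j ×ₗ Fin t) = j * t := by
    rw [← Fintype.card_congr (toLex (α := Fin j × Fin t)), Fintype.card_prod, Fintype.card_fin,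
      Fintype.card_fin]
  rw [hc] at h
  -- The fiber over `τ` pairs `j` with `τ⁻¹` and `t` with `τ`; reindexing by inversion swaps the
  -- roles.
  rw [← h, ← Equiv.sum_comp (Equiv.inv _)]
  refine Finset.sum_congr rfl fun τ _ => ?_
  rw [card_monotone_sort_fiber, card_filter_compatibleWith, card_filter_compatibleWith,
    Equiv.inv_apply, inv_inv]

/-- The two-sided Eulerian identity of Carlitz, Roselle and Scoville. -/
theorem mul_multichooseSeries_eq_sum_perm (n : ℕ) :
    PowerSeries.C ((1 - PowerSeries.X) ^ (n + 2)) *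
        ((1 - PowerSeries.X) ^ (n + 2) * multichooseSeries (n + 1)) =
      ∑ σ : Equiv.Perm (Fin (n + 1)), (PowerSeries.X : PowerSeries (PowerSeries ℚ)) ^
        (permDes σ + 1) * PowerSeries.C (PowerSeries.X ^ (permDes σ⁻¹ + 1)) := by
  have h : multichooseSeries (n + 1) = ∑ σ : Equiv.Perm (Fin (n + 1)),
      (PowerSeries.mk fun j => (Nat.multichoose (j - permDes σ) (n + 1) : PowerSeries ℚ)) *
        PowerSeries.C
          (PowerSeries.mk fun t => (Nat.multichoose (t - permDes σ⁻¹) (n + 1) : ℚ)) := by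
    ext j t
    rw [map_sum, map_sum, multichooseSeries, PowerSeries.coeff_mk, PowerSeries.coeff_mk,
      multichoose_mul_eq_sum_perm, Nat.cast_sum]
    refine Finset.sum_congr rfl fun σ _ => ?_
    rw [PowerSeries.coeff_mul_C, PowerSeries.coeff_mk, ← map_natCast (PowerSeries.C (R := ℚ)),
      PowerSeries.coeff_C_mul, PowerSeries.coeff_mk, Nat.cast_mul]
  rw [h, Finset.mul_sum, Finset.mul_sum]
  refine Finset.sum_congr rfl fun σ _ => ?_
  rw [← mul_assoc ((1 - PowerSeries.X) ^ (n + 2)), one_sub_X_pow_mul_mk_multichoose_sub,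
    mul_left_comm, ← map_mul, one_sub_X_pow_mul_mk_multichoose_sub]

/-! ### Summation over the colors -/

/-- The exponents `b ≥ e` together with `r + b` for `b < e` fill the interval from `e` to `e + r -
1` once each. -/
theorem sum_range_pow_shift {S : Type*} [CommRing S] (y : S) {e r : ℕ} (he : e ≤ r) :
    ∑ b ∈ Finset.range r, y ^ (r * (if b < e then 1 else 0) + b) =
      y ^ e * ∑ b ∈ Finset.range r, y ^ b := by
  obtain ⟨f, rfl⟩ := Nat.exists_eq_add_of_le he
  conv_rhs => rw [add_comm e f]
  rw [Finset.sum_range_add, Finset.sum_range_add, mul_add, Finset.mul_sum, Finset.mul_sum,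
    add_comm]
  congr 1
  · refine Finset.sum_congr rfl fun b _ => ?_
    rw [if_neg (by omega), ← pow_add, mul_zero, zero_add]
  · refine Finset.sum_congr rfl fun b hb => ?_
    rw [if_pos (Finset.mem_range.mp hb), ← pow_add, mul_one, add_assoc]

/-- The flag descent number of a color word for a prescribed set `D` of descents of the underlying
permutation. -/
def wordFlagDes {r n : ℕ} (D : Fin n → Prop) [DecidablePred D] (c : Fin (n + 1) → Fin r) : ℕ :=
  r * (∑ i : Fin n, if c i.castSucc > c i.succ ∨ (c i.castSucc = c i.succ ∧ D i) then 1 else 0) +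
    c (Fin.last n)

theorem wordFlagDes_cons {r n : ℕ} (D : Fin (n + 1) → Prop) [DecidablePred D] (a : Fin r)
    (c : Fin (n + 1) → Fin r) :
    wordFlagDes D (Fin.cons a c : Fin (n + 2) → Fin r) =
      r * (if a > c 0 ∨ (a = c 0 ∧ D 0) then 1 else 0) +
        wordFlagDes (fun i => D i.succ) c := by
  rw [wordFlagDes, wordFlagDes, Fin.sum_univ_succ, ← Fin.succ_last, Fin.cons_succ,
    Fin.castSucc_zero, Fin.cons_zero, Fin.cons_succ, mul_add, add_assoc]
  simp only [Fin.castSucc_succ, Fin.cons_succ]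

/-- A descent of the permutation raises the threshold for the next color from `a` to `a + 1`, since
equal colors then count too. -/
theorem sum_color_shift {S : Type*} [CommRing S] (y : S) {r : ℕ} (a : Fin r) (D : Prop)
    [Decidable D] :
    ∑ b : Fin r, y ^ (r * (if a > b ∨ (a = b ∧ D) then 1 else 0) + (b : ℕ)) =
      y ^ ((a : ℕ) + if D then 1 else 0) * ∑ b ∈ Finset.range r, y ^ b := by
  rw [← sum_range_pow_shift y (by have := a.isLt; split_ifs <;> omega), Finset.sum_range]
  refine Finset.sum_congr rfl fun b _ => ?_
  have h : (a > b ∨ (a = b ∧ D)) ↔ (b : ℕ) < (a : ℕ) + if D then 1 else 0 := by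
    rw [gt_iff_lt, Fin.lt_def, Fin.ext_iff]
    by_cases hD : D
    · simp only [hD, if_true, and_true]
      omega
    · simp [hD]
  simp only [h]

theorem sum_eq_sum_sum_cons {α S : Type*} [Fintype α] [AddCommMonoid S] {n : ℕ}
    (f : (Fin (n + 1) → α) → S) :
    ∑ c, f c = ∑ a, ∑ c : Fin n → α, f (Fin.cons a c) := by
  rw [← (Fin.consEquiv fun _ => α).sum_comp, Fintype.sum_prod_type]
  rfl

/-- Fixing the first color makes the induction work: summing over the next color `b` trades `y^b`
for `y^(a + [D 0])` times a full geometric sum, so the color dependence passes down the word. -/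
theorem sum_wordFlagDes_cons {S : Type*} [CommRing S] (y : S) {r n : ℕ} (D : Fin n → Prop)
    [DecidablePred D] (a : Fin r) :
    ∑ c : Fin n → Fin r, y ^ wordFlagDes D (Fin.cons a c : Fin (n + 1) → Fin r) =
      y ^ ((a : ℕ) + ∑ i, if D i then 1 else 0) * (∑ b ∈ Finset.range r, y ^ b) ^ n := by
  induction n generalizing a with
  | zero => simp [wordFlagDes]
  | succ n ih =>
    rw [sum_eq_sum_sum_cons]
    simp only [wordFlagDes_cons D, Fin.cons_zero, pow_add y (r * _)]
    simp only [← Finset.mul_sum]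
    have hrec : ∀ b : Fin r, ∑ c : Fin n → Fin r,
        y ^ wordFlagDes (fun i => D i.succ) (Fin.cons b c : Fin (n + 1) → Fin r) =
        y ^ (b : ℕ) * (y ^ (∑ i : Fin n, if D i.succ then 1 else 0) *
          (∑ b ∈ Finset.range r, y ^ b) ^ n) := by
      intro b
      rw [ih (fun i => D i.succ) b, pow_add, mul_assoc]
    have hstep := sum_color_shift y a (D 0)
    simp only [pow_add y (r * _)] at hstep
    simp only [hrec, ← mul_assoc]
    rw [← Finset.sum_mul, ← Finset.sum_mul, hstep, Fin.sum_univ_succ (fun i => if D i then 1 else 0)]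
    ring

theorem sum_wordFlagDes {S : Type*} [CommRing S] (y : S) (r : ℕ) {n : ℕ} (D : Fin n → Prop)
    [DecidablePred D] :
    ∑ c : Fin (n + 1) → Fin r, y ^ wordFlagDes D c =
      y ^ (∑ i, if D i then 1 else 0) * (∑ b ∈ Finset.range r, y ^ b) ^ (n + 1) := by
  rw [sum_eq_sum_sum_cons]
  simp only [sum_wordFlagDes_cons, pow_add]
  rw [← Finset.sum_mul, ← Finset.sum_mul, ← Finset.sum_range fun b => y ^ b]
  ring

theorem sum_flagDes {S : Type*} [CommRing S] (y : S) (r : ℕ) {n : ℕ}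
    (σ : Equiv.Perm (Fin (n + 1))) :
    ∑ c : Fin (n + 1) → Fin r, y ^ flagDes ((σ, c) : ColoredPerm r (n + 1)) =
      y ^ permDes σ * (∑ b ∈ Finset.range r, y ^ b) ^ (n + 1) := by
  rw [permDes, Finset.card_filter, ← sum_wordFlagDes]
  simp only [wordFlagDes, flagDes, coloredDes, Finset.card_filter]

theorem biEulerian_succ (r n : ℕ) :
    biEulerian r (n + 1) = ∑ p : ColoredPerm r (n + 1),
      Polynomial.X ^ (flagDes p + 1) *
        Polynomial.C ((PowerSeries.X : PowerSeries ℚ) ^ (permDes p.1⁻¹ + 1)) := by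
  have hcolor : ∑ p : ColoredPerm r (n + 1),
      (Polynomial.X : Polynomial (PowerSeries ℚ)) ^ (flagDes p + 1) *
        Polynomial.C ((PowerSeries.X : PowerSeries ℚ) ^ (permDes p.1⁻¹ + 1)) =
      (∑ b ∈ Finset.range r, Polynomial.X ^ b) ^ (n + 1) *
        ∑ σ : Equiv.Perm (Fin (n + 1)), Polynomial.X ^ (permDes σ + 1) *
          Polynomial.C ((PowerSeries.X : PowerSeries ℚ) ^ (permDes σ⁻¹ + 1)) := by
    rw [Fintype.sum_prod_type, Finset.mul_sum]
    refine Finset.sum_congr rfl fun σ _ => ?_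
    simp only [pow_succ _ (flagDes _)]
    rw [← Finset.sum_mul, ← Finset.sum_mul, sum_flagDes]
    ring
  have hcoe : ((∑ σ : Equiv.Perm (Fin (n + 1)), Polynomial.X ^ (permDes σ + 1) *
      Polynomial.C ((PowerSeries.X : PowerSeries ℚ) ^ (permDes σ⁻¹ + 1)) :
        Polynomial (PowerSeries ℚ)) : PowerSeries (PowerSeries ℚ)) =
      ∑ σ : Equiv.Perm (Fin (n + 1)), (PowerSeries.X : PowerSeries (PowerSeries ℚ)) ^
        (permDes σ + 1) * PowerSeries.C (PowerSeries.X ^ (permDes σ⁻¹ + 1)) := by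
    rw [← Polynomial.coeToPowerSeries.ringHom_apply, map_sum]
    simp
  have hgeom : ((∑ b ∈ Finset.range r, Polynomial.X ^ b : Polynomial (PowerSeries ℚ)) :
      PowerSeries (PowerSeries ℚ)) * (1 - PowerSeries.X) = 1 - PowerSeries.X ^ r := by
    rw [← geom_sum_mul_neg, ← Polynomial.coeToPowerSeries.ringHom_apply, map_sum]
    simp
  -- In power series over `y`, `1 - y^r` is the geometric sum times `1 - y`, so one spare factor `1
  -- - y` completes the exponent `n + 2`; nothing is divided.
  apply Polynomial.coe_injective
  rw [hcolor, Polynomial.coe_mul, Polynomial.coe_pow, hcoe, ← mul_multichooseSeries_eq_sum_perm,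
    coe_biEulerian r (n + 1) n.succ_pos, ← hgeom, mul_pow]
  ring

theorem mainTheorem8 (r : ℕ) (hr : 0 < r) :
    (∀ n : ℕ, biEulerian r (n + 1) =
      ∑ p : ColoredPerm r (n + 1),
        Polynomial.X ^ (flagDes p + 1) *
          Polynomial.C ((PowerSeries.X : PowerSeries ℚ) ^ (permDes p.1⁻¹ + 1))) ∧
    biEulerian r 0 = 1 ∧
    Summable (fun m : ℕ => ogfTerm r m) ∧
    biEulerianOGF r = (1 - varY) * (1 - varZ) * ∑' m : ℕ, ogfTerm r m := by
  refine ⟨biEulerian_succ r, biEulerian_zero r, (hasSum_ogfTerm r).summable, ?_⟩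
  rw [(hasSum_ogfTerm r).tsum_eq, biEulerianOGF_eq]
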